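/- Let $K$ be a compact metric space and let $V=\{V(x)\}_{x\in K}$ be a non-negative sample-continuous process with $\mathbb E\,V(x)=1$ for all $x\in K$. Let $\Gamma_1<\Gamma_2<\dots$ be the arrival times of a unit rate Poisson process on $(0,\infty)$ (that is, $\Gamma_1,\Gamma_2-\Gamma_1,\Gamma_3-\Gamma_2,\dots$ are independent standard exponential random variables), and let $V_1,V_2,\dots$ be independent sample-continuous copies of $V$, independent of $(\Gamma_j)_{j\ge 1}$. Let $Z=\{Z(x)\}_{x\in K}$ be a non-negative sample-continuous process with spectral representation $$\{Z(x)\}_{x\in K}=\Big\{\max_{j\ge1}\Gamma_j^{-1}V_j(x)\Big\}_{x\in K}\quad\text{in distribution,}$$ so that $Z$ is a max-stable process with unit Fréchet margins. Write $\varphi_j=\Gamma_j^{-1}V_j$, and call $\varphi_j$ extremal if $\varphi_j(x)=\max_{k\ge 1}\varphi_k(x)$ for some $x\in K$. For a threshold $\tau>0$, the threshold stopping approximation is $\max_{j\le T_\tau}\varphi_j$ with $T_\tau=\min\{j\ge 1:\ \Gamma_{j+1}^{-1}\tau<\inf_{x\in K}\max_{k\le j}\varphi_k(x)\}$, and the number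 of extremal functions missing from it is $$M_\tau=\Big|\Big\{j\ge 1:\ \varphi_j \text{ is extremal and } \Gamma_j^{-1}\tau\le\inf_{x\in K}\max_{k<j}\varphi_k(x)\Big\}\Big|,$$ where the maximum over the empty set ($j=1$) is $0$. Then $M_\tau$ is a (possibly infinite) random variable, measurable up to null sets, and $$\mathbb E(M_\tau)\ \le\ \mathbb E\Big\{\sup_{x\in K}\frac{V(x)}{Z(x)}-\sup_{x\in K}\frac{\tau}{Z(x)}\Big\}_+ ,$$ where, on the right-hand side, $Z$ and $V$ are independent and $\{\cdot\}_+$ denotes the positive part; both sides are understood in $[0,\infty]$. -/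

import Mathlib

open MeasureTheory ProbabilityTheory
open scoped ENNReal NNReal

namespace MaxStable

/-- The waiting times between consecutive arrivals (the first one is counted from time `0`). -/
def interarrival {Ω : Type*} (Γ : ℕ → Ω → ℝ) : ℕ → Ω → ℝ
  | 0 => Γ 0
  | j + 1 => fun ω => Γ (j + 1) ω - Γ j ω

/-- `Γ 0, Γ 1, Γ 2, …` are the successive arrival times of a unit rate Poisson process on
`(0, ∞)`: the interarrival times are independent and standard exponential. -/
structure IsUnitPoissonArrivals {Ω : Type*} [MeasurableSpace Ω] (Γ : ℕ → Ω → ℝ)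
    (P : Measure Ω) : Prop where
  measurable : ∀ j, Measurable (Γ j)
  indep : iIndepFun (interarrival Γ) P
  law : ∀ j, P.map (interarrival Γ j) = expMeasure 1

/-- A non-negative stochastic process indexed by `K` all of whose sample paths are continuous
(measurability is with respect to the product σ-algebra on `K → ℝ≥0`). -/
structure IsSampleContinuousProcess {K Ω : Type*} [TopologicalSpace K] [MeasurableSpace Ω]
    (X : Ω → K → ℝ≥0) : Prop where
  measurable : Measurable X
  continuous : ∀ ω, Continuous (X ω)

/-- A spectral process: a non-negative sample-continuous process with `E V(x) = 1` for all `x`. -/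
structure IsSpectralProcess {K Ω : Type*} [TopologicalSpace K] [MeasurableSpace Ω]
    (V : Ω → K → ℝ≥0) (P : Measure Ω) : Prop extends IsSampleContinuousProcess V where
  mean_one : ∀ x, ∫⁻ ω, (V ω x : ℝ≥0∞) ∂P = 1

/-- Unit rate Poisson arrival times `Γ` on `(Ω, P)` with independent marks `Vs 0, Vs 1, …`, which
are independent sample-continuous copies of the process `V` on `(Ω', P')`. -/
structure IsMarkedPoisson {K Ω Ω' : Type*} [TopologicalSpace K] [MeasurableSpace Ω]
    [MeasurableSpace Ω'] (Γ : ℕ → Ω → ℝ) (Vs : ℕ → Ω → K → ℝ≥0) (P : Measure Ω)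
    (V : Ω' → K → ℝ≥0) (P' : Measure Ω') : Prop where
  arrivals : IsUnitPoissonArrivals Γ P
  marks : ∀ j, IsSampleContinuousProcess (Vs j)
  marks_law : ∀ j, IdentDistrib (Vs j) V P P'
  marks_indep : iIndepFun Vs P
  indep : IndepFun (fun ω j => Γ j ω) (fun ω j => Vs j ω) P

section

variable {K Ω : Type*} (Γ : ℕ → Ω → ℝ) (Vs : ℕ → Ω → K → ℝ≥0)

/-- The random function `φ_j = Γ_j⁻¹ V_j`. -/
noncomputable def phi (j : ℕ) (ω : Ω) (x : K) : ℝ≥0∞ :=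
  (Vs j ω x : ℝ≥0∞) / ENNReal.ofReal (Γ j ω)

/-- The full pointwise maximum `Z^(∞)(x) = max_j Γ_j⁻¹ V_j(x)`. -/
noncomputable def fullMax (ω : Ω) (x : K) : ℝ≥0∞ := ⨆ j, phi Γ Vs j ω x

/-- The pointwise maximum of the functions `φ_k` that precede `φ_j`; it is `0` for the first
function. -/
noncomputable def maxBefore (j : ℕ) (ω : Ω) (x : K) : ℝ≥0∞ := ⨆ k < j, phi Γ Vs k ω x

/-- `φ_j` is an extremal function: it attains the full maximum at some point of `K`. -/
def IsExtremal (j : ℕ) (ω : Ω) : Prop := ∃ x, phi Γ Vs j ω x = fullMax Γ Vs ω x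

/-- The indices of the extremal functions `φ_j` missed by threshold stopping at level `τ`:
those with `Γ_j⁻¹ τ ≤ inf_x max_{k < j} φ_k(x)`. -/
def missing (τ : ℝ≥0) (ω : Ω) : Set ℕ :=
  {j | IsExtremal Γ Vs j ω ∧ (τ : ℝ≥0∞) / ENNReal.ofReal (Γ j ω) ≤ ⨅ x, maxBefore Γ Vs j ω x}

/-- The number `M_τ ∈ {0, 1, …, ∞}` of missing extremal functions. -/
noncomputable def numMissing (τ : ℝ≥0) (ω : Ω) : ℝ≥0∞ := ((missing Γ Vs τ ω).encard : ℝ≥0∞)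

end

end MaxStable

/-! Suppose φ_j is missing, and let Z_j be the maximum of all the other functions. The functions
before φ_j are among them, so τ/Γ_j ≤ Z_j everywhere, while φ_j ≥ Z_j at some point. Hence Γ_j lies
between sup τ/Z_j and sup V_j/Z_j (`indicator_missing_le_candidate`). Both bounds depend only on the
mark V_j and on the remaining points, so Mecke's formula (`tsum_lintegral_skip_le`) replaces Γ_j by
a Lebesgue variable γ, V_j by V and Z_j by an independent copy of Z. Integrating over γ leaves the
length of the interval, which is the positive part (`lintegral_candidate_le`).

Mecke's formula is obtained from the gaps. Deleting an arrival merges two neighbouring gaps, and the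
product of two exponential densities depends only on their sum; so the merged gaps are again i.i.d.
exponential, weighted by Lebesgue measure for the deleted point on the merged interval
(`lintegral_mergeAt`). These intervals are disjoint, so the sum over j is at most an integral over
the line.

Measurability needs an argument because extremality quantifies over all of K. Finiteness of sup Z
and the second Borel–Cantelli lemma force sup V_k = o(k), while Γ_k grows linearly, so φ_k → 0
uniformly almost surely (`IsMarkedPoisson.ae_eventually_phi_le`). Under the threshold condition the
full maximum is then a maximum of finitely many continuous functions, and being missing can be
tested on a countable dense set (`mem_missing_iff`). -/

namespace MaxStable

open Filter Topology

/-! ### Deleting, inserting and merging entries of sequences -/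

/-- The increasing enumeration of the natural numbers different from `j`. -/
def skip (j k : ℕ) : ℕ := if k < j then k else k + 1

/-- The sequence `u` with `a` inserted at position `j`. -/
def insertAt {X : Type*} (j : ℕ) (a : X) (u : ℕ → X) (i : ℕ) : X :=
  if i < j then u i else if i = j then a else u (i - 1)

/-- The sequence `e` with the entries at positions `j` and `j + 1` replaced by their sum. -/
def mergeAt (j : ℕ) (e : ℕ → ℝ) (i : ℕ) : ℝ :=
  if i < j then e i else if i = j then e j + e (j + 1) else e (i + 1)

lemma skip_injective (j : ℕ) : Function.Injective (skip j) := by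
  intro a b h
  simp only [skip] at h
  split_ifs at h <;> omega

lemma skip_ne (j k : ℕ) : skip j k ≠ j := by
  simp only [skip]; split_ifs <;> omega

lemma range_skip (j : ℕ) : Set.range (skip j) = {i | i ≠ j} := by
  ext i
  constructor
  · rintro ⟨k, rfl⟩; exact skip_ne j k
  · intro hi
    rcases lt_or_gt_of_ne hi with h | h
    · exact ⟨i, by simp [skip, h]⟩
    · exact ⟨i - 1, by simp only [skip]; split_ifs <;> omega⟩

@[simp] lemma insertAt_self {X : Type*} (j : ℕ) (a : X) (u : ℕ → X) : insertAt j a u j = a := by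
  simp [insertAt]

@[simp] lemma insertAt_skip {X : Type*} (j k : ℕ) (a : X) (u : ℕ → X) :
    insertAt j a u (skip j k) = u k := by
  simp only [insertAt, skip]
  split_ifs <;> first | rfl | omega

lemma measurable_insertAt {X : Type*} [MeasurableSpace X] (j : ℕ) :
    Measurable fun p : X × (ℕ → X) => insertAt j p.1 p.2 := by
  refine measurable_pi_lambda _ fun i => ?_
  simp only [insertAt]
  split_ifs <;> fun_prop

lemma measurable_mergeAt (j : ℕ) : Measurable (mergeAt j) := by
  refine measurable_pi_lambda _ fun i => ?_
  simp only [mergeAt]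
  split_ifs <;> fun_prop

/-- Inserting an independent entry into an i.i.d. sequence gives an i.i.d. sequence. -/
lemma map_insertAt_prod_infinitePi {X : Type*} [MeasurableSpace X] (μ : Measure X)
    [IsProbabilityMeasure μ] (j : ℕ) :
    (μ.prod (Measure.infinitePi fun _ : ℕ => μ)).map (fun p => insertAt j p.1 p.2) =
      Measure.infinitePi fun _ : ℕ => μ := by
  refine Measure.eq_infinitePi _ fun s t ht => ?_
  rw [Measure.map_apply (measurable_insertAt j)
    (MeasurableSet.pi s.countable_toSet fun i _ => ht i)]
  have hpre : (fun p : X × (ℕ → X) => insertAt j p.1 p.2) ⁻¹' (Set.pi s t) =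
      (if j ∈ s then t j else Set.univ) ×ˢ
        Set.pi (s.preimage (skip j) (skip_injective j).injOn) (fun k => t (skip j k)) := by
    ext ⟨a, u⟩
    simp only [Set.mem_preimage, Set.mem_pi, Finset.mem_coe, Set.mem_prod, Finset.mem_preimage]
    constructor
    · intro h
      refine ⟨?_, fun k hk => by simpa using h _ hk⟩
      split_ifs with hj
      · simpa using h j hj
      · trivial
    · rintro ⟨h1, h2⟩ i hi
      by_cases hij : i = j
      · subst hij; simpa [hi] using h1
      · obtain ⟨k, rfl⟩ : i ∈ Set.range (skip j) := by rw [range_skip]; exact hij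
        simpa using h2 k hi
  classical
  have hf : (s.filter fun i => i ∈ Set.range (skip j)) = s.erase j := by
    ext i; simp [range_skip, and_comm]
  rw [hpre, Measure.prod_prod, Measure.infinitePi_pi _ (fun i _ => ht _),
    Finset.prod_preimage' (skip j) s (skip_injective j).injOn fun i => μ (t i), hf]
  split_ifs with hj
  · exact Finset.mul_prod_erase s (fun i => μ (t i)) hj
  · simp [Finset.erase_eq_of_notMem hj]

lemma lintegral_infinitePi_insertAt {X : Type*} [MeasurableSpace X] (μ : Measure X)
    [IsProbabilityMeasure μ] (j : ℕ) {f : (ℕ → X) → ℝ≥0∞} (hf : Measurable f) :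
    ∫⁻ u, f u ∂(Measure.infinitePi fun _ : ℕ => μ) =
      ∫⁻ a, ∫⁻ u, f (insertAt j a u) ∂(Measure.infinitePi fun _ : ℕ => μ) ∂μ := by
  conv_lhs => rw [← map_insertAt_prod_infinitePi μ j]
  rw [lintegral_map hf (measurable_insertAt j),
    lintegral_prod (fun p : X × (ℕ → X) => f (insertAt j p.1 p.2))
      (hf.comp (measurable_insertAt j)).aemeasurable]

lemma mergeAt_insertAt_insertAt (j : ℕ) (a b : ℝ) (r : ℕ → ℝ) :
    mergeAt j (insertAt j a (insertAt j b r)) = insertAt j (a + b) r := by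
  funext i
  simp only [mergeAt, insertAt]
  split_ifs <;> first | rfl | omega

lemma sum_range_insertAt (j : ℕ) (a : ℝ) (r : ℕ → ℝ) :
    ∑ i ∈ Finset.range j, insertAt j a r i = ∑ i ∈ Finset.range j, r i :=
  Finset.sum_congr rfl fun i hi => by simp [insertAt, Finset.mem_range.1 hi]

/-- Arrivals are partial sums of gaps: merging the gaps on both sides of the arrival `j` deletes
exactly that arrival. -/
lemma sum_range_mergeAt (j k : ℕ) (e : ℕ → ℝ) :
    ∑ i ∈ Finset.range (k + 1), mergeAt j e i = ∑ i ∈ Finset.range (skip j k + 1), e i := by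
  induction k with
  | zero =>
    simp only [skip, mergeAt]
    split_ifs with h
    · simp [h]
    · obtain rfl : j = 0 := by omega
      simp [Finset.sum_range_succ]
  | succ k ih =>
    rw [Finset.sum_range_succ, ih]
    simp only [skip, mergeAt]
    split_ifs <;> try omega
    · rw [Finset.sum_range_succ _ (k + 1)]
    · obtain rfl : j = k + 1 := by omega
      rw [Finset.sum_range_succ _ (k + 1 + 1), Finset.sum_range_succ _ (k + 1)]; ring
    · rw [Finset.sum_range_succ _ (k + 1 + 1)]

/-! ### Exponential gaps and the removal of one arrival -/

instance isProbabilityMeasure_expMeasure_one : IsProbabilityMeasure (expMeasure 1) :=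
  isProbabilityMeasure_expMeasure one_pos

lemma lintegral_expMeasure {f : ℝ → ℝ≥0∞} (hf : Measurable f) :
    ∫⁻ x, f x ∂(expMeasure 1) = ∫⁻ x, exponentialPDF 1 x * f x := by
  have hm : Measurable (gammaPDF 1 1) := (measurable_gammaPDFReal 1 1).ennreal_ofReal
  rw [expMeasure, gammaMeasure, lintegral_withDensity_eq_lintegral_mul _ hm hf]
  rfl

/-- The exponents add up to -s whatever a is; the indicator records where both densities are
nonzero. -/
lemma exponentialPDF_mul_exponentialPDF_sub (a s : ℝ) :
    exponentialPDF 1 a * exponentialPDF 1 (s - a) =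
      exponentialPDF 1 s * (Set.Icc 0 s).indicator 1 a := by
  simp only [exponentialPDF_eq, Set.indicator, Set.mem_Icc]
  by_cases h0 : 0 ≤ a <;> by_cases h1 : a ≤ s
  · have : 0 ≤ s := h0.trans h1
    simp only [h0, sub_nonneg, h1, this, and_self, if_true, Pi.one_apply, mul_one, one_mul]
    rw [← ENNReal.ofReal_mul (Real.exp_pos _).le, ← Real.exp_add]
    congr 2; ring
  all_goals simp [h0, h1]

lemma measurable_exponentialPDF (r : ℝ) : Measurable (exponentialPDF r) :=
  (measurable_exponentialPDFReal r).ennreal_ofReal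

/-- Given the sum `s` of two independent exponential variables, the first one is uniform on
`[0, s]`. -/
lemma lintegral_expMeasure_add {f : ℝ → ℝ → ℝ≥0∞} (hf : Measurable (Function.uncurry f)) :
    ∫⁻ a, ∫⁻ b, f a (a + b) ∂(expMeasure 1) ∂(expMeasure 1) =
      ∫⁻ s, (∫⁻ a in Set.Ico 0 s, f a s) ∂(expMeasure 1) := by
  have hp := measurable_exponentialPDF 1
  have hf' : Measurable fun p : ℝ × ℝ => f p.1 p.2 := hf
  have hind : Measurable fun p : ℝ × ℝ => (Set.Icc 0 p.2).indicator (1 : ℝ → ℝ≥0∞) p.1 := by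
    have : MeasurableSet {p : ℝ × ℝ | 0 ≤ p.1 ∧ p.1 ≤ p.2} :=
      (measurableSet_le measurable_const measurable_fst).inter
        (measurableSet_le measurable_fst measurable_snd)
    exact (measurable_const (a := (1 : ℝ≥0∞))).indicator this
  calc ∫⁻ a, ∫⁻ b, f a (a + b) ∂(expMeasure 1) ∂(expMeasure 1)
      = ∫⁻ a, exponentialPDF 1 a * ∫⁻ b, exponentialPDF 1 b * f a (a + b) := by
        rw [lintegral_expMeasure]
        · congr with a
          rw [lintegral_expMeasure]
          fun_prop
        · exact (hf'.comp (by fun_prop : Measurable fun p : ℝ × ℝ =>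
            (p.1, p.1 + p.2))).lintegral_prod_right'
    _ = ∫⁻ a, exponentialPDF 1 a * ∫⁻ s, exponentialPDF 1 (s - a) * f a s := by
        congr with a
        congr 1
        rw [← lintegral_add_left_eq_self (fun s => exponentialPDF 1 (s - a) * f a s) a]
        simp
    _ = ∫⁻ a, ∫⁻ s, exponentialPDF 1 s * ((Set.Icc 0 s).indicator 1 a * f a s) := by
        congr with a
        rw [← lintegral_const_mul]
        · congr with s
          rw [← mul_assoc, exponentialPDF_mul_exponentialPDF_sub, mul_assoc]
        · fun_prop
    _ = ∫⁻ s, ∫⁻ a, exponentialPDF 1 s * ((Set.Icc 0 s).indicator 1 a * f a s) := by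
        rw [lintegral_lintegral_swap]
        exact ((hp.comp measurable_snd).mul (hind.mul hf')).aemeasurable
    _ = ∫⁻ s, exponentialPDF 1 s * ∫⁻ a in Set.Ico 0 s, f a s := by
        congr with s
        rw [lintegral_const_mul]
        · congr 1
          -- The endpoint s is a null set. Half-open intervals are preferred because consecutive
          -- ones are disjoint.
          rw [restrict_Ico_eq_restrict_Icc, ← lintegral_indicator measurableSet_Icc]
          congr with a
          by_cases h : a ∈ Set.Icc 0 s <;> simp [Set.indicator, h]
        · exact (hind.comp (by fun_prop : Measurable fun a : ℝ => (a, s))).mul (by fun_prop)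
    _ = _ := by
        rw [lintegral_expMeasure]
        simp_rw [restrict_Ico_eq_restrict_Icc, ← lintegral_indicator measurableSet_Icc]
        have : Measurable fun p : ℝ × ℝ =>
            (Set.Icc 0 p.1).indicator (fun a => f a p.1) p.2 := by
          have hs : MeasurableSet {p : ℝ × ℝ | 0 ≤ p.2 ∧ p.2 ≤ p.1} :=
            (measurableSet_le measurable_const measurable_snd).inter
              (measurableSet_le measurable_snd measurable_fst)
          exact (hf'.comp measurable_swap).indicator hs
        exact this.lintegral_prod_right'

lemma measurable_setLIntegral_Ico {X : Type*} [MeasurableSpace X] {h : ℝ → X → ℝ≥0∞}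
    (hh : Measurable (Function.uncurry h)) {a b : X → ℝ} (ha : Measurable a) (hb : Measurable b) :
    Measurable fun x => ∫⁻ γ in Set.Ico (a x) (b x), h γ x := by
  simp_rw [← lintegral_indicator measurableSet_Ico]
  have hs : MeasurableSet {p : X × ℝ | a p.1 ≤ p.2 ∧ p.2 < b p.1} :=
    (measurableSet_le (by fun_prop) measurable_snd).inter
      (measurableSet_lt measurable_snd (by fun_prop))
  exact ((hh.comp measurable_swap).indicator hs).lintegral_prod_right'

/-- Removing the `j`-th arrival of a unit rate Poisson process leaves a unit rate Poisson process,
and the removed arrival is distributed according to Lebesgue measure between the `j`-th and the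
`(j+1)`-st of the remaining ones. -/
lemma lintegral_mergeAt (j : ℕ) {h : ℝ → (ℕ → ℝ) → ℝ≥0∞}
    (hh : Measurable (Function.uncurry h)) :
    ∫⁻ e, h (∑ i ∈ Finset.range (j + 1), e i) (mergeAt j e)
        ∂(Measure.infinitePi fun _ : ℕ => expMeasure 1) =
      ∫⁻ e, (∫⁻ γ in Set.Ico (∑ i ∈ Finset.range j, e i) (∑ i ∈ Finset.range (j + 1), e i), h γ e)
        ∂(Measure.infinitePi fun _ : ℕ => expMeasure 1) := by
  set π := Measure.infinitePi fun _ : ℕ => expMeasure 1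
  have hh' : Measurable fun p : ℝ × (ℕ → ℝ) => h p.1 p.2 := hh
  have hins : Measurable fun p : ℝ × (ℕ → ℝ) => insertAt j p.1 p.2 := measurable_insertAt j
  have hmerge := measurable_mergeAt j
  have hF : Measurable fun e : ℕ → ℝ => h (∑ i ∈ Finset.range (j + 1), e i) (mergeAt j e) :=
    hh'.comp ((by fun_prop : Measurable fun e : ℕ → ℝ =>
      ∑ i ∈ Finset.range (j + 1), e i).prodMk hmerge)
  have hG : Measurable fun e : ℕ → ℝ => ∫⁻ γ in
      Set.Ico (∑ i ∈ Finset.range j, e i) (∑ i ∈ Finset.range (j + 1), e i), h γ e :=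
    measurable_setLIntegral_Ico hh (by fun_prop) (by fun_prop)
  rw [lintegral_infinitePi_insertAt _ j hF, lintegral_infinitePi_insertAt _ j hG]
  have hsum : ∀ (s : ℝ) (r : ℕ → ℝ), ∑ i ∈ Finset.range (j + 1), insertAt j s r i =
      ∑ i ∈ Finset.range j, r i + s := fun s r => by
    rw [Finset.sum_range_succ, sum_range_insertAt, insertAt_self]
  have hF' : ∀ a, Measurable fun r : ℕ → ℝ =>
      h (∑ i ∈ Finset.range (j + 1), insertAt j a r i) (mergeAt j (insertAt j a r)) := fun a =>
    hF.comp (hins.comp (by fun_prop : Measurable fun r : ℕ → ℝ => (a, r)))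
  -- On the left two gaps are split off, a before and b after the removed arrival; on the right only
  -- the merged gap s is. What remains is the two-variable identity for s = a + b.
  simp_rw [fun a => lintegral_infinitePi_insertAt (expMeasure 1) j (hF' a),
    mergeAt_insertAt_insertAt, hsum, sum_range_insertAt]
  have hK : Measurable fun p : (ℕ → ℝ) × ℝ × ℝ =>
      h (∑ i ∈ Finset.range j, p.1 i + p.2.1) (insertAt j p.2.2 p.1) :=
    hh'.comp ((by fun_prop : Measurable fun p : (ℕ → ℝ) × ℝ × ℝ =>
      ∑ i ∈ Finset.range j, p.1 i + p.2.1).prodMk (hins.comp (by fun_prop : Measurable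
        fun p : (ℕ → ℝ) × ℝ × ℝ => (p.2.2, p.1))))
  calc ∫⁻ a, ∫⁻ b, ∫⁻ r, h (∑ i ∈ Finset.range j, r i + a) (insertAt j (a + b) r) ∂π
          ∂(expMeasure 1) ∂(expMeasure 1)
      = ∫⁻ r, ∫⁻ a, ∫⁻ b, h (∑ i ∈ Finset.range j, r i + a) (insertAt j (a + b) r)
          ∂(expMeasure 1) ∂(expMeasure 1) ∂π := by
        have hswap : ∀ a : ℝ, ∫⁻ b, ∫⁻ r, h (∑ i ∈ Finset.range j, r i + a)
            (insertAt j (a + b) r) ∂π ∂(expMeasure 1) =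
            ∫⁻ r, ∫⁻ b, h (∑ i ∈ Finset.range j, r i + a)
              (insertAt j (a + b) r) ∂(expMeasure 1) ∂π := fun a => by
          rw [lintegral_lintegral_swap]
          exact (hK.comp (by fun_prop : Measurable fun p : ℝ × (ℕ → ℝ) =>
            (p.2, a, a + p.1))).aemeasurable
        simp_rw [hswap]
        rw [lintegral_lintegral_swap]
        exact (Measurable.lintegral_prod_right' (f := fun q : (ℝ × (ℕ → ℝ)) × ℝ =>
            h (∑ i ∈ Finset.range j, q.1.2 i + q.1.1) (insertAt j (q.1.1 + q.2) q.1.2))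
            (hK.comp (by fun_prop : Measurable fun q : (ℝ × (ℕ → ℝ)) × ℝ =>
              (q.1.2, q.1.1, q.1.1 + q.2)))).aemeasurable
    _ = ∫⁻ r, ∫⁻ s, (∫⁻ a in Set.Ico 0 s, h (∑ i ∈ Finset.range j, r i + a) (insertAt j s r))
          ∂(expMeasure 1) ∂π := by
        congr with r
        exact lintegral_expMeasure_add (f := fun a s =>
          h (∑ i ∈ Finset.range j, r i + a) (insertAt j s r))
          (hK.comp (by fun_prop : Measurable fun p : ℝ × ℝ => (r, p.1, p.2)))
    _ = ∫⁻ r, ∫⁻ s, (∫⁻ γ in Set.Ico (∑ i ∈ Finset.range j, r i) (∑ i ∈ Finset.range j, r i + s),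
          h γ (insertAt j s r)) ∂(expMeasure 1) ∂π := by
        congr with r
        congr with s
        simp_rw [← lintegral_indicator measurableSet_Ico]
        conv_rhs => rw [← lintegral_add_left_eq_self _ (∑ i ∈ Finset.range j, r i)]
        congr with a
        simp [Set.indicator]
    _ = _ := by
        rw [lintegral_lintegral_swap]
        have := hG.comp hins
        simp only [Function.comp_def, hsum, sum_range_insertAt] at this
        exact (this.comp measurable_swap).aemeasurable

lemma ae_nonneg_expMeasure : ∀ᵐ x ∂(expMeasure 1), 0 ≤ x := by
  have hs : MeasurableSet {x : ℝ | ¬ 0 ≤ x} := measurableSet_Ici.compl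
  rw [ae_iff, ← lintegral_indicator_one hs,
    lintegral_expMeasure (measurable_one.indicator hs)]
  refine (lintegral_congr fun x => ?_).trans lintegral_zero
  by_cases hx : 0 ≤ x
  · simp [hx]
  · simp [exponentialPDF_of_neg (not_le.1 hx)]

/-- Since the gaps are almost surely nonnegative, the intervals between consecutive arrivals are
disjoint, so their integrals add up to at most the integral over the whole line. -/
lemma tsum_lintegral_mergeAt_le {h : ℝ → (ℕ → ℝ) → ℝ≥0∞} (hh : Measurable (Function.uncurry h)) :
    ∑' j, ∫⁻ e, h (∑ i ∈ Finset.range (j + 1), e i) (mergeAt j e)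
        ∂(Measure.infinitePi fun _ : ℕ => expMeasure 1) ≤
      ∫⁻ e, (∫⁻ γ, h γ e) ∂(Measure.infinitePi fun _ : ℕ => expMeasure 1) := by
  simp_rw [lintegral_mergeAt _ hh]
  rw [← lintegral_tsum fun j =>
    (measurable_setLIntegral_Ico hh (by fun_prop) (by fun_prop)).aemeasurable]
  have hpos : ∀ᵐ e ∂(Measure.infinitePi fun _ : ℕ => expMeasure 1), ∀ i, 0 ≤ e i :=
    ae_all_iff.2 fun i => (measurePreserving_eval_infinitePi
      (fun _ : ℕ => expMeasure 1) i).quasiMeasurePreserving.ae ae_nonneg_expMeasure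
  refine lintegral_mono_ae (hpos.mono fun e he => ?_)
  have hmono : Monotone fun j => ∑ i ∈ Finset.range j, e i :=
    monotone_nat_of_le_succ fun j => by rw [Finset.sum_range_succ]; linarith [he j]
  have hdisj : Pairwise (Function.onFun Disjoint fun j =>
      Set.Ico (∑ i ∈ Finset.range j, e i) (∑ i ∈ Finset.range (j + 1), e i)) :=
    hmono.pairwise_disjoint_on_Ico_succ
  rw [← lintegral_iUnion (fun _ => measurableSet_Ico) hdisj]
  exact setLIntegral_le_lintegral _ _

/-! ### Mecke's inequality for marked arrivals -/

/-- The partial sums of a sequence of gaps. -/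
def arrivalsOf (e : ℕ → ℝ) (k : ℕ) : ℝ := ∑ i ∈ Finset.range (k + 1), e i

lemma measurable_arrivalsOf : Measurable arrivalsOf :=
  measurable_pi_lambda _ fun k => by unfold arrivalsOf; fun_prop

lemma arrivalsOf_mergeAt (j : ℕ) (e : ℕ → ℝ) :
    arrivalsOf (mergeAt j e) = fun k => arrivalsOf e (skip j k) :=
  funext fun k => sum_range_mergeAt j k e

lemma arrivalsOf_interarrival {Ω : Type*} (Γ : ℕ → Ω → ℝ) (ω : Ω) :
    arrivalsOf (fun k => interarrival Γ k ω) = fun k => Γ k ω := by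
  funext k
  induction k with
  | zero => simp [arrivalsOf, interarrival]
  | succ k ih =>
    rw [arrivalsOf, Finset.sum_range_succ, ← arrivalsOf, ih]
    simp [interarrival]

lemma IsUnitPoissonArrivals.measurable_interarrival {Ω : Type*} [MeasurableSpace Ω]
    {Γ : ℕ → Ω → ℝ} {P : Measure Ω} (hΓ : IsUnitPoissonArrivals Γ P) (j : ℕ) :
    Measurable (interarrival Γ j) := by
  cases j with
  | zero => exact hΓ.measurable 0
  | succ j => exact (hΓ.measurable (j + 1)).sub (hΓ.measurable j)

/-- The joint law of the gaps and the marks of a marked Poisson process. -/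
lemma map_interarrival_marks {Ω X : Type*} [MeasurableSpace Ω] [MeasurableSpace X]
    {P : Measure Ω} [IsProbabilityMeasure P] {μ : Measure X} {Γ : ℕ → Ω → ℝ} {v : ℕ → Ω → X}
    (hΓ : IsUnitPoissonArrivals Γ P) (hv : ∀ j, Measurable (v j)) (hlaw : ∀ j, P.map (v j) = μ)
    (hvi : iIndepFun v P) (hind : IndepFun (fun ω j => Γ j ω) (fun ω j => v j ω) P) :
    P.map (fun ω => (fun j => interarrival Γ j ω, fun j => v j ω)) =
      (Measure.infinitePi fun _ : ℕ => expMeasure 1).prod (Measure.infinitePi fun _ : ℕ => μ) := by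
  have hgap : Measurable fun (y : ℕ → ℝ) (j : ℕ) => interarrival (fun k (z : ℕ → ℝ) => z k) j y :=
    measurable_pi_lambda _ fun j => by
      cases j <;> simp only [interarrival] <;> fun_prop
  have hind' : IndepFun (fun ω j => interarrival Γ j ω) (fun ω j => v j ω) P := by
    have := hind.comp hgap measurable_id
    convert! this using 1
    funext ω j
    cases j <;> rfl
  have hm := hΓ.measurable_interarrival
  rw [hind'.map_prod_eq_prod_map_map (measurable_pi_lambda _ hm).aemeasurable
    (measurable_pi_lambda _ hv).aemeasurable, hΓ.indep.map_fun_eq_infinitePi_map hm,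
    hvi.map_fun_eq_infinitePi_map hv]
  simp_rw [hΓ.law, hlaw]

/-- Mecke's inequality for a marked unit rate Poisson process enumerated by its arrival times. -/
theorem tsum_lintegral_skip_le {Ω X : Type*} [MeasurableSpace Ω] [MeasurableSpace X]
    {P : Measure Ω} [IsProbabilityMeasure P] {μ : Measure X} [IsProbabilityMeasure μ]
    {Γ : ℕ → Ω → ℝ} {v : ℕ → Ω → X}
    (hΓ : IsUnitPoissonArrivals Γ P) (hv : ∀ j, Measurable (v j)) (hlaw : ∀ j, P.map (v j) = μ)
    (hvi : iIndepFun v P) (hind : IndepFun (fun ω j => Γ j ω) (fun ω j => v j ω) P)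
    {g : ℝ → X → (ℕ → ℝ) → (ℕ → X) → ℝ≥0∞}
    (hg : Measurable fun p : ℝ × X × (ℕ → ℝ) × (ℕ → X) => g p.1 p.2.1 p.2.2.1 p.2.2.2) :
    ∑' j, ∫⁻ ω, g (Γ j ω) (v j ω) (fun k => Γ (skip j k) ω) (fun k => v (skip j k) ω) ∂P ≤
      ∫⁻ γ, ∫⁻ a, ∫⁻ ω, g γ a (fun k => Γ k ω) (fun k => v k ω) ∂P ∂μ := by
  set πE := Measure.infinitePi fun _ : ℕ => expMeasure 1
  set πV := Measure.infinitePi fun _ : ℕ => μ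
  have hA := measurable_arrivalsOf
  have hjm : Measurable fun ω => (fun j => interarrival Γ j ω, fun j => v j ω) :=
    (measurable_pi_lambda _ hΓ.measurable_interarrival).prodMk (measurable_pi_lambda _ hv)
  have hlawint : ∀ {F : (ℕ → ℝ) → (ℕ → X) → ℝ≥0∞}, Measurable (Function.uncurry F) →
      ∫⁻ ω, F (fun k => interarrival Γ k ω) (fun k => v k ω) ∂P = ∫⁻ e, ∫⁻ u, F e u ∂πV ∂πE := by
    intro F hF
    refine Eq.trans ?_ (lintegral_prod (Function.uncurry F) hF.aemeasurable)
    rw [← map_interarrival_marks hΓ hv hlaw hvi hind, lintegral_map hF hjm]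
    rfl
  -- All marks are averaged out first, which reduces the claim to a statement about the gaps alone.
  let h : ℝ → (ℕ → ℝ) → ℝ≥0∞ := fun γ e => ∫⁻ a, ∫⁻ u, g γ a (arrivalsOf e) u ∂πV ∂μ
  have hg3 : Measurable fun q : (ℝ × (ℕ → ℝ)) × X =>
      ∫⁻ u, g q.1.1 q.2 (arrivalsOf q.1.2) u ∂πV :=
    Measurable.lintegral_prod_right' (f := fun r : ((ℝ × (ℕ → ℝ)) × X) × (ℕ → X) =>
      g r.1.1.1 r.1.2 (arrivalsOf r.1.1.2) r.2)
      (hg.comp (by fun_prop : Measurable fun r : ((ℝ × (ℕ → ℝ)) × X) × (ℕ → X) =>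
        (r.1.1.1, r.1.2, arrivalsOf r.1.1.2, r.2)))
  have hh : Measurable (Function.uncurry h) := hg3.lintegral_prod_right'
  have hterm : ∀ j, ∫⁻ ω, g (Γ j ω) (v j ω) (fun k => Γ (skip j k) ω)
      (fun k => v (skip j k) ω) ∂P =
      ∫⁻ e, h (∑ i ∈ Finset.range (j + 1), e i) (mergeAt j e) ∂πE := by
    intro j
    have hAm := measurable_mergeAt j
    have hFm : Measurable fun p : (ℕ → ℝ) × (ℕ → X) =>
        g (arrivalsOf p.1 j) (p.2 j) (arrivalsOf (mergeAt j p.1)) (fun k => p.2 (skip j k)) :=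
      hg.comp (by fun_prop : Measurable fun p : (ℕ → ℝ) × (ℕ → X) =>
        (arrivalsOf p.1 j, p.2 j, arrivalsOf (mergeAt j p.1), fun k => p.2 (skip j k)))
    have h1 := hlawint (F := fun e u => g (arrivalsOf e j) (u j) (arrivalsOf (mergeAt j e))
      (fun k => u (skip j k))) hFm
    simp_rw [arrivalsOf_mergeAt, arrivalsOf_interarrival] at h1
    rw [h1]
    refine lintegral_congr fun e => ?_
    have hFe := hFm.comp (by fun_prop : Measurable fun u : ℕ → X => (e, u))
    simp only [Function.comp_def, arrivalsOf_mergeAt] at hFe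
    -- For i.i.d. marks, the mark `j` can be split off, and the others, relabelled by `skip j`, have
    -- the law of the full sequence.
    rw [lintegral_infinitePi_insertAt μ j hFe]
    simp only [insertAt_self, insertAt_skip, h, arrivalsOf_mergeAt]
    rfl
  simp_rw [hterm]
  refine (tsum_lintegral_mergeAt_le hh).trans (le_of_eq ?_)
  rw [lintegral_lintegral_swap (f := fun e γ => h γ e) (hh.comp measurable_swap).aemeasurable]
  refine lintegral_congr fun γ => ?_
  simp only [h]
  rw [lintegral_lintegral_swap (f := fun e a => ∫⁻ u, g γ a (arrivalsOf e) u ∂πV)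
    (hg3.comp (by fun_prop : Measurable fun q : (ℕ → ℝ) × X =>
    ((γ, q.1), q.2))).aemeasurable]
  refine lintegral_congr fun a => ?_
  rw [← hlawint (F := fun e u => g γ a (arrivalsOf e) u)
    (hg.comp (by fun_prop : Measurable fun p : (ℕ → ℝ) × (ℕ → X) => (γ, a, arrivalsOf p.1, p.2)))]
  simp_rw [arrivalsOf_interarrival]

/-! ### Growth of arrival times and of i.i.d. sequences -/

lemma ae_pos_expMeasure : ∀ᵐ x ∂(expMeasure 1), 0 < x := by
  have hac : expMeasure 1 ≪ volume := withDensity_absolutelyContinuous _ _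
  have h0 : ∀ᵐ x ∂(expMeasure 1), x ≠ 0 := hac.ae_le (Measure.ae_ne volume 0)
  filter_upwards [ae_nonneg_expMeasure, h0] with x h1 h2 using lt_of_le_of_ne h1 h2.symm

lemma integrable_id_expMeasure : Integrable (fun x : ℝ => x) (expMeasure 1) := by
  have hm : Measurable fun x : ℝ => ‖x‖ₑ := by fun_prop
  refine ⟨by fun_prop, ?_⟩
  -- The mean of the exponential law is Euler's integral for Γ(2).
  have hG : IntegrableOn (fun x : ℝ => Real.exp (-x) * x ^ ((2 : ℝ) - 1)) (Set.Ioi 0) :=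
    Real.GammaIntegral_convergent two_pos
  have hle : ∫⁻ x : ℝ, exponentialPDF 1 x * ‖x‖ₑ ≤
      ∫⁻ x in Set.Ioi (0 : ℝ), ‖Real.exp (-x) * x ^ ((2 : ℝ) - 1)‖ₑ := by
    rw [← lintegral_indicator measurableSet_Ioi]
    refine lintegral_mono fun x => ?_
    rcases lt_trichotomy x 0 with hx | rfl | hx
    · simp [exponentialPDF_of_neg hx]
    · simp
    · have h2 : (2 : ℝ) - 1 = 1 := by norm_num
      simp only [exponentialPDF_of_nonneg hx.le, Set.indicator, Set.mem_Ioi, hx, if_true, h2,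
        Real.rpow_one, one_mul, enorm_mul]
      rw [Real.enorm_of_nonneg (Real.exp_pos _).le]
  rw [hasFiniteIntegral_iff_enorm, lintegral_expMeasure hm]
  exact hle.trans_lt hG.2

/-- The law of large numbers for the arrival times. -/
lemma IsUnitPoissonArrivals.exists_tendsto {Ω : Type*} [MeasurableSpace Ω] {Γ : ℕ → Ω → ℝ}
    {P : Measure Ω} [IsProbabilityMeasure P] (hΓ : IsUnitPoissonArrivals Γ P) :
    ∃ m : ℝ, 0 < m ∧
      ∀ᵐ ω ∂P, Tendsto (fun n : ℕ => Γ n ω / ((n : ℝ) + 1)) atTop (𝓝 m) := by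
  have hm := hΓ.measurable_interarrival
  have hid : ∀ i, IdentDistrib (interarrival Γ i) (fun x : ℝ => x) P (expMeasure 1) := fun i =>
    ⟨(hm i).aemeasurable, aemeasurable_id, by
      rw [hΓ.law i]; exact Measure.map_id.symm⟩
  have hint : Integrable (interarrival Γ 0) P := (hid 0).integrable_iff.2 integrable_id_expMeasure
  refine ⟨P[interarrival Γ 0], ?_, ?_⟩
  · rw [(hid 0).integral_eq, integral_pos_iff_support_of_nonneg_ae
      (ae_nonneg_expMeasure) integrable_id_expMeasure]
    have : (Function.support fun x : ℝ => x)ᶜ = {x | ¬ x ≠ 0} := by ext; simp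
    have h0 : expMeasure 1 (Function.support fun x : ℝ => x)ᶜ = 0 :=
      this ▸ ae_iff.1 (ae_pos_expMeasure.mono fun x hx => hx.ne')
    have h1 : MeasurableSet (Function.support fun x : ℝ => x) := measurableSet_support measurable_id
    rw [(prob_compl_eq_zero_iff h1).1 h0]
    exact one_pos
  · have := strong_law_ae_real (interarrival Γ) hint
      (fun i j hij => hΓ.indep.indepFun hij) fun i => (hid i).trans (hid 0).symm
    filter_upwards [this] with ω hω
    -- `Γ n` is the sum of n + 1 gaps, hence the shifted index.
    refine (hω.comp (tendsto_add_atTop_nat 1)).congr fun n => ?_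
    have := congrFun (arrivalsOf_interarrival Γ ω) n
    simp only [arrivalsOf] at this
    simp [this]

lemma IsUnitPoissonArrivals.ae_pos {Ω : Type*} [MeasurableSpace Ω] {Γ : ℕ → Ω → ℝ}
    {P : Measure Ω} (hΓ : IsUnitPoissonArrivals Γ P) : ∀ᵐ ω ∂P, ∀ j, 0 < Γ j ω := by
  have : ∀ᵐ ω ∂P, ∀ j, 0 < interarrival Γ j ω := ae_all_iff.2 fun j => by
    refine ae_of_ae_map (hΓ.measurable_interarrival j).aemeasurable (p := fun x => 0 < x) ?_
    rw [hΓ.law j]; exact ae_pos_expMeasure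
  filter_upwards [this] with ω hω j
  rw [← congrFun (arrivalsOf_interarrival Γ ω) j]
  exact Finset.sum_pos (fun i _ => hω i) (by simp)

/-- Each q is the quotient k / L for exactly L values of k. -/
lemma tsum_comp_div {f : ℕ → ℝ≥0∞} (L : ℕ) [NeZero L] :
    ∑' k, f (k / L) = L * ∑' q, f q := by
  rw [← (Nat.divModEquiv L).symm.tsum_eq, ENNReal.tsum_prod', ← ENNReal.tsum_mul_left]
  refine tsum_congr fun q => ?_
  rw [tsum_fintype]
  have hdiv : ∀ b : Fin L, (q * L + b) / L = q := fun b => by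
    rw [mul_comm, Nat.mul_add_div (NeZero.pos L), Nat.div_eq_of_lt b.2, add_zero]
  simp [hdiv]

/-- If i.i.d. random variables are almost surely of at most linear growth, then they are almost
surely of sublinear growth. -/
lemma ae_eventually_mul_le {Ω : Type*} [MeasurableSpace Ω] {P : Measure Ω} [IsProbabilityMeasure P]
    {M : ℕ → Ω → ℝ≥0∞} (hM : ∀ k, Measurable (M k)) (hi : iIndepFun M P)
    (hlaw : ∀ k, P.map (M k) = P.map (M 0))
    (hgrow : ∀ᵐ ω ∂P, ∃ C : ℕ, ∀ k : ℕ, M k ω ≤ C * ((k : ℝ≥0∞) + 1)) :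
    ∀ᵐ ω ∂P, ∀ N : ℕ, ∀ᶠ k : ℕ in atTop, N * M k ω ≤ (k : ℝ≥0∞) + 1 := by
  have hms : ∀ (c : ℝ≥0∞) k, MeasurableSet {ω | c < M k ω} := fun c k =>
    measurableSet_lt measurable_const (hM k)
  have htail : ∀ (c : ℝ≥0∞) k, P {ω | c < M k ω} = P {ω | c < M 0 ω} := fun c k => by
    have h1 : ∀ i, P {ω | c < M i ω} = P.map (M i) (Set.Ioi c) := fun i => by
      rw [Measure.map_apply (hM i) measurableSet_Ioi]; rfl
    rw [h1, h1, hlaw]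
  obtain ⟨C, hC⟩ : ∃ C : ℕ, ∑' k : ℕ, P {ω | C * ((k : ℝ≥0∞) + 1) < M k ω} ≠ ∞ := by
    -- If the series diverged for every C, the second Borel–Cantelli lemma would give M_k > C(k+1)
    -- infinitely often for every C, against the linear growth bound.
    by_contra! hcon
    have hall : ∀ᵐ ω ∂P, ∀ C : ℕ, ∃ᶠ k : ℕ in atTop, C * ((k : ℝ≥0∞) + 1) < M k ω := by
      refine ae_all_iff.2 fun C => ?_
      have hind : iIndepSet (fun k : ℕ => {ω | C * ((k : ℝ≥0∞) + 1) < M k ω}) P :=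
        (iIndepSet_iff_meas_biInter fun k => hms _ k).2 fun s =>
          hi.meas_biInter fun k _ => ⟨Set.Ioi (C * ((k : ℝ≥0∞) + 1)), measurableSet_Ioi, rfl⟩
      have h1 := measure_limsup_eq_one (fun k : ℕ => hms (C * ((k : ℝ≥0∞) + 1)) k) hind (hcon C)
      have h2 := (prob_compl_eq_zero_iff (MeasurableSet.measurableSet_limsup
        fun k : ℕ => hms (C * ((k : ℝ≥0∞) + 1)) k)).2 h1
      rw [ae_iff]
      convert! h2 using 2
      ext ω
      simp [mem_limsup_iff_frequently_mem]
    obtain ⟨ω, ⟨C, h1⟩, h2⟩ := (hgrow.and hall).exists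
    obtain ⟨k, hk⟩ := (h2 C).exists
    exact absurd hk (not_lt.2 (h1 k))
  -- C + 1 instead of C keeps the factor positive, so that L below is nonzero.
  have hC' : ∑' q : ℕ, P {ω | ((C + 1 : ℕ) : ℝ≥0∞) * q < M 0 ω} ≠ ∞ := by
    rw [tsum_eq_zero_add' ENNReal.summable]
    refine ENNReal.add_ne_top.2 ⟨measure_ne_top _ _, ne_top_of_le_ne_top hC ?_⟩
    refine ENNReal.tsum_le_tsum fun k => ?_
    rw [← htail _ k]
    refine measure_mono fun ω hω => ?_
    simp only [Set.mem_ofPred_eq] at hω ⊢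
    refine lt_of_le_of_lt ?_ hω
    push_cast
    gcongr
    exact le_self_add
  refine ae_all_iff.2 fun N => ?_
  rcases Nat.eq_zero_or_pos N with rfl | hN
  · simp
  -- If M_k ≤ (C+1)⌊k/L⌋, then N M_k ≤ L⌊k/L⌋ ≤ k. So the tail series at level (k+1)/N is at most L
  -- times the convergent one, and the first Borel–Cantelli lemma applies.
  set L := N * (C + 1)
  have hL : 0 < L := by positivity
  have : NeZero L := ⟨hL.ne'⟩
  have hsum : ∑' k : ℕ, P {ω | (k : ℝ≥0∞) + 1 < N * M k ω} ≠ ∞ := by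
    refine ne_top_of_le_ne_top (ENNReal.mul_ne_top (ENNReal.natCast_ne_top L) hC') ?_
    rw [← tsum_comp_div (f := fun q : ℕ => P {ω | ((C + 1 : ℕ) : ℝ≥0∞) * q < M 0 ω})]
    refine ENNReal.tsum_le_tsum fun k => ?_
    rw [← htail _ k]
    refine measure_mono fun ω hω => ?_
    by_contra hcon
    simp only [Set.mem_ofPred_eq, not_lt] at hcon hω
    have h1 : (N : ℝ≥0∞) * M k ω ≤ k := by
      calc (N : ℝ≥0∞) * M k ω ≤ N * (((C + 1 : ℕ) : ℝ≥0∞) * ((k / L : ℕ) : ℝ≥0∞)) := by gcongr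
        _ = ((L * (k / L) : ℕ) : ℝ≥0∞) := by simp only [L]; push_cast; ring
        _ ≤ k := by exact_mod_cast Nat.mul_div_le k L
    exact absurd (hω.trans_le h1) (not_lt.2 le_self_add)
  filter_upwards [ae_eventually_notMem hsum] with ω hω
  exact hω.mono fun k hk => not_lt.1 hk

/-! ### Uniform decay of the functions φ_k -/

lemma iSup_subtype_dense {K : Type*} [TopologicalSpace K] {D : Set K} (hD : Dense D)
    {f : K → ℝ≥0∞} (hf : Continuous f) : ⨆ x : D, f x = ⨆ x, f x := by
  refine le_antisymm (iSup_le fun x => le_iSup f x) (iSup_le fun x => ?_)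
  have hc : IsClosed {y | f y ≤ ⨆ x : D, f x} := isClosed_le hf continuous_const
  exact closure_minimal (fun y hy => le_iSup (fun x : D => f x) ⟨y, hy⟩) hc (hD x)

lemma iSup_coe_lt_top {K : Type*} [TopologicalSpace K] [CompactSpace K] {f : K → ℝ≥0}
    (hf : Continuous f) : ⨆ x, (f x : ℝ≥0∞) < ∞ := by
  obtain ⟨C, hC⟩ := (isCompact_range hf).bddAbove
  exact lt_of_le_of_lt (iSup_le fun x => ENNReal.coe_le_coe.2 (hC ⟨x, rfl⟩)) ENNReal.coe_lt_top

section

variable {K Ω Ω' : Type*} [MetricSpace K] [CompactSpace K] [MeasurableSpace Ω] [MeasurableSpace Ω']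
  {P : Measure Ω} [IsProbabilityMeasure P] {P' : Measure Ω'} {V Z : Ω' → K → ℝ≥0}
  {Γ : ℕ → Ω → ℝ} {Vs : ℕ → Ω → K → ℝ≥0}

/-- Almost surely, the functions `φ_k` converge to zero uniformly. -/
lemma IsMarkedPoisson.ae_eventually_phi_le (hΓV : IsMarkedPoisson Γ Vs P V P')
    (hZ : IsSampleContinuousProcess Z)
    (hrep : IdentDistrib (fun ω x => (Z ω x : ℝ≥0∞)) (fullMax Γ Vs) P' P) :
    ∀ᵐ ω ∂P, ∀ ε : ℝ≥0, 0 < ε → ∀ᶠ k in atTop, ∀ x, phi Γ Vs k ω x ≤ ε := by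
  obtain ⟨D, hDc, hD⟩ := TopologicalSpace.exists_countable_dense K
  have := hDc.to_subtype
  obtain ⟨m, hm, hslln⟩ := hΓV.arrivals.exists_tendsto
  have hF : Measurable fun v : K → ℝ≥0 => ⨆ x : D, (v x : ℝ≥0∞) :=
    .iSup fun x : D => (measurable_pi_apply (x : K)).coe_nnreal_ennreal
  let M : ℕ → Ω → ℝ≥0∞ := fun k ω => ⨆ x : D, (Vs k ω x : ℝ≥0∞)
  have hsup : ∀ k ω, M k ω = ⨆ x, (Vs k ω x : ℝ≥0∞) := fun k ω =>
    iSup_subtype_dense hD (ENNReal.continuous_coe.comp ((hΓV.marks k).continuous ω))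
  have hMi : iIndepFun M P := hΓV.marks_indep.comp (fun _ v => ⨆ x : D, (v x : ℝ≥0∞)) fun _ => hF
  have hlaw : ∀ k, P.map (M k) = P.map (M 0) := fun k =>
    (((hΓV.marks_law k).trans (hΓV.marks_law 0).symm).comp hF).map_eq
  -- Integrability of sup V is not assumed. The control on the marks comes from sup Z < ∞, which
  -- holds by continuity on a compact space and passes to `fullMax` through its law.
  have hfin : ∀ᵐ ω ∂P, ⨆ x : D, fullMax Γ Vs ω x < ∞ := by
    have h1 : Measurable fun z : K → ℝ≥0∞ => ⨆ x : D, z x := .iSup fun x : D => measurable_pi_apply (x : K)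
    refine (hrep.comp h1).ae_mem_snd (t := Set.Iio ∞) measurableSet_Iio
      (Eventually.of_forall fun ω => ?_)
    exact lt_of_le_of_lt (iSup_le fun x : D => le_iSup (fun x => (Z ω x : ℝ≥0∞)) x)
      (iSup_coe_lt_top (hZ.continuous ω))
  have hgrow : ∀ᵐ ω ∂P, ∃ C : ℕ, ∀ k : ℕ, M k ω ≤ C * ((k : ℝ≥0∞) + 1) := by
    filter_upwards [hfin, hslln, hΓV.arrivals.ae_pos] with ω h1 h2 hpos
    obtain ⟨B, hB⟩ := h2.bddAbove_range
    obtain ⟨C, hC⟩ := ENNReal.exists_nat_gt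
      (ENNReal.mul_ne_top h1.ne (ENNReal.ofReal_ne_top (r := B)))
    refine ⟨C, fun k => iSup_le fun x => ?_⟩
    have h3 : phi Γ Vs k ω x ≤ ⨆ x : D, fullMax Γ Vs ω x :=
      (le_iSup (fun k => phi Γ Vs k ω x) k).trans (le_iSup (fun x : D => fullMax Γ Vs ω x) x)
    have h4 : Γ k ω ≤ B * (k + 1) := (div_le_iff₀ (by positivity)).1 (hB ⟨k, rfl⟩)
    rw [phi, ENNReal.div_le_iff (by simpa using hpos k) ENNReal.ofReal_ne_top] at h3
    have h5 : ENNReal.ofReal (Γ k ω) ≤ ENNReal.ofReal B * ((k : ℝ≥0∞) + 1) := by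
      refine (ENNReal.ofReal_le_ofReal h4).trans (le_of_eq ?_)
      rw [ENNReal.ofReal_mul' (by positivity), ENNReal.ofReal_add (by positivity) zero_le_one]
      simp
    calc (Vs k ω x : ℝ≥0∞) ≤ _ := h3
      _ ≤ (⨆ x : D, fullMax Γ Vs ω x) * (ENNReal.ofReal B * ((k : ℝ≥0∞) + 1)) := by gcongr
      _ ≤ C * ((k : ℝ≥0∞) + 1) := by rw [← mul_assoc]; gcongr
  filter_upwards [ae_eventually_mul_le (fun k => hF.comp (hΓV.marks k).measurable) hMi hlaw hgrow,
    hslln] with ω h1 h2 ε hε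
  -- With Γ_k > (m/2)(k+1), this N gives V_k ≤ (k+1)/N ≤ ε(m/2)(k+1) ≤ εΓ_k.
  obtain ⟨N, hN⟩ := exists_nat_gt (2 / (ε * m))
  have hN0 : (0 : ℝ) < N := lt_of_le_of_lt (by positivity) hN
  filter_upwards [h1 N, h2.eventually_const_lt (half_lt_self hm)] with k hk1 hk2 x
  rw [lt_div_iff₀ (by positivity)] at hk2
  refine ENNReal.div_le_of_le_mul ?_
  have h3 : (N : ℝ≥0∞) * Vs k ω x ≤ (k : ℝ≥0∞) + 1 := by
    refine le_trans ?_ hk1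
    gcongr
    refine le_trans ?_ (hsup k ω).ge
    exact le_iSup (fun x => (Vs k ω x : ℝ≥0∞)) x
  have h4 : (N : ℝ) * Vs k ω x ≤ k + 1 := by exact_mod_cast h3
  have h5 : (Vs k ω x : ℝ) ≤ ε * Γ k ω := by
    have h6 : 2 < ε * m * N := by
      rw [div_lt_iff₀ (by positivity)] at hN; linarith
    have hε' : (0 : ℝ) < ε := hε
    have h7 : (N : ℝ) * Vs k ω x ≤ N * (ε * (m / 2 * (k + 1))) := by nlinarith
    exact (le_of_mul_le_mul_left h7 hN0).trans (by gcongr)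
  calc (Vs k ω x : ℝ≥0∞) = ENNReal.ofReal (Vs k ω x) := by simp
    _ ≤ ENNReal.ofReal (ε * Γ k ω) := ENNReal.ofReal_le_ofReal h5
    _ = ε * ENNReal.ofReal (Γ k ω) := by rw [ENNReal.ofReal_mul ε.coe_nonneg]; simp

end

/-! ### Missing extremal functions seen from a dense set -/

section

variable {K Ω : Type*} {Γ : ℕ → Ω → ℝ} {Vs : ℕ → Ω → K → ℝ≥0}

lemma phi_le_fullMax (j : ℕ) (ω : Ω) (x : K) : phi Γ Vs j ω x ≤ fullMax Γ Vs ω x :=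
  le_iSup (fun j => phi Γ Vs j ω x) j

lemma maxBefore_le_fullMax (j : ℕ) (ω : Ω) (x : K) :
    maxBefore Γ Vs j ω x ≤ fullMax Γ Vs ω x :=
  iSup₂_le fun k _ => phi_le_fullMax k ω x

lemma maxBefore_eq_sup (j : ℕ) (ω : Ω) (x : K) :
    maxBefore Γ Vs j ω x = (Finset.range j).sup fun k => phi Γ Vs k ω x := by
  simp [maxBefore, Finset.sup_eq_iSup]

/-- The maximum of the functions other than `φ_j` dominates that of those preceding `φ_j`. -/
lemma maxBefore_le_fullMax_skip (j : ℕ) (ω : Ω) (x : K) :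
    maxBefore Γ Vs j ω x ≤
      fullMax (fun k => Γ (skip j k)) (fun k => Vs (skip j k)) ω x := by
  refine iSup₂_le fun k hk => ?_
  refine le_trans (le_of_eq ?_) (phi_le_fullMax k ω x)
  simp [phi, skip, hk]

lemma fullMax_skip_le_fullMax (j : ℕ) (ω : Ω) (x : K) :
    fullMax (fun k => Γ (skip j k)) (fun k => Vs (skip j k)) ω x ≤ fullMax Γ Vs ω x :=
  iSup_le fun k => phi_le_fullMax (skip j k) ω x

/-- Late functions are at most c everywhere, so they cannot exceed the maximum of the first j; only
finitely many functions matter, which makes the full maximum continuous. -/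
lemma exists_fullMax_eq_maxBefore {ω : Ω}
    (hunif : ∀ ε : ℝ≥0, 0 < ε → ∀ᶠ k in atTop, ∀ x, phi Γ Vs k ω x ≤ ε) {j : ℕ} {c : ℝ≥0}
    (hc : 0 < c) (hcj : ∀ x, (c : ℝ≥0∞) ≤ maxBefore Γ Vs j ω x) :
    ∃ n, fullMax Γ Vs ω = maxBefore Γ Vs n ω := by
  obtain ⟨N, hN⟩ := eventually_atTop.1 (hunif c hc)
  refine ⟨max N j, funext fun x => le_antisymm (iSup_le fun k => ?_) (maxBefore_le_fullMax _ _ _)⟩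
  rcases lt_or_ge k (max N j) with hk | hk
  · exact le_iSup₂ (f := fun k (_ : k < max N j) => phi Γ Vs k ω x) k hk
  · refine ((hN k ((le_max_left _ _).trans hk) x).trans (hcj x)).trans (iSup₂_le fun i hi => ?_)
    exact le_iSup₂ (f := fun k (_ : k < max N j) => phi Γ Vs k ω x) i
      (hi.trans_le (le_max_right _ _))

lemma maxBefore_ne_top {ω : Ω} (hpos : ∀ j, 0 < Γ j ω) (n : ℕ) (x : K) :
    maxBefore Γ Vs n ω x ≠ ∞ := by
  rw [maxBefore_eq_sup]
  refine ((Finset.sup_lt_iff ENNReal.zero_lt_top).2 fun k _ => ?_).ne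
  exact ENNReal.div_lt_top ENNReal.coe_ne_top (by simpa using hpos k)

lemma numMissing_eq_tsum (τ : ℝ≥0) (ω : Ω) :
    numMissing Γ Vs τ ω = ∑' j, (missing Γ Vs τ ω).indicator 1 j := by
  rw [numMissing, ← ENNReal.tsum_set_one, ← tsum_subtype]
  rfl

section

variable [TopologicalSpace K] {ω : Ω}

lemma continuous_phi (hpos : ∀ j, 0 < Γ j ω) (hc : ∀ j, Continuous (Vs j ω)) (j : ℕ) :
    Continuous (phi Γ Vs j ω) :=
  (ENNReal.continuous_div_const _ (by simpa using hpos j)).comp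
    (ENNReal.continuous_coe.comp (hc j))

lemma continuous_maxBefore (hpos : ∀ j, 0 < Γ j ω) (hc : ∀ j, Continuous (Vs j ω)) (j : ℕ) :
    Continuous (maxBefore Γ Vs j ω) := by
  simp_rw [funext (maxBefore_eq_sup (Γ := Γ) (Vs := Vs) j ω)]
  exact Continuous.finset_sup_apply fun k _ => continuous_phi hpos hc k

/-- The missing extremal functions are determined by the values on a dense set. -/
lemma mem_missing_iff [CompactSpace K] {D : Set K} (hD : Dense D) (hpos : ∀ j, 0 < Γ j ω)
    (hc : ∀ j, Continuous (Vs j ω))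
    (hunif : ∀ ε : ℝ≥0, 0 < ε → ∀ᶠ k in atTop, ∀ x, phi Γ Vs k ω x ≤ ε) {τ : ℝ≥0} (hτ : 0 < τ)
    (j : ℕ) :
    j ∈ missing Γ Vs τ ω ↔
      (∀ x : D, (τ : ℝ≥0∞) / ENNReal.ofReal (Γ j ω) ≤ maxBefore Γ Vs j ω x) ∧
        ENNReal.ofReal (Γ j ω) ≤ ⨆ x : D, (Vs j ω x : ℝ≥0∞) / fullMax Γ Vs ω x := by
  have hG0 : ENNReal.ofReal (Γ j ω) ≠ 0 := by simpa using hpos j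
  have hGt : ENNReal.ofReal (Γ j ω) ≠ ∞ := ENNReal.ofReal_ne_top
  have hcond : (τ : ℝ≥0∞) / ENNReal.ofReal (Γ j ω) ≤ ⨅ x, maxBefore Γ Vs j ω x ↔
      ∀ x : D, (τ : ℝ≥0∞) / ENNReal.ofReal (Γ j ω) ≤ maxBefore Γ Vs j ω x := by
    rw [le_iInf_iff]
    refine ⟨fun h x => h x, fun h x => ?_⟩
    have hcl : IsClosed {x | (τ : ℝ≥0∞) / ENNReal.ofReal (Γ j ω) ≤ maxBefore Γ Vs j ω x} :=
      isClosed_le continuous_const (continuous_maxBefore hpos hc j)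
    exact closure_minimal (fun y hy => h ⟨y, hy⟩) hcl (hD x)
  rw [missing, Set.mem_ofPred_eq, ← hcond, and_comm]
  refine and_congr_right fun hle => ?_
  -- The extremality criterion is proved only under the threshold condition. That condition bounds
  -- the maximum below by c = τ/Γ_j, which is positive because τ > 0; so the full maximum is
  -- positive, finite and continuous, and V_j divided by it attains its supremum.
  have hle' := le_iInf_iff.1 hle
  obtain ⟨c, hcτ⟩ : ∃ c : ℝ≥0, (c : ℝ≥0∞) = (τ : ℝ≥0∞) / ENNReal.ofReal (Γ j ω) :=
    ⟨_, ENNReal.coe_toNNReal (ENNReal.div_lt_top ENNReal.coe_ne_top hG0).ne⟩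
  have hc0 : (0 : ℝ≥0∞) < c := by
    rw [hcτ]; exact ENNReal.div_pos (by simpa using hτ.ne') hGt
  rw [← hcτ] at hle'
  have hfull0 : ∀ x, fullMax Γ Vs ω x ≠ 0 := fun x =>
    (hc0.trans_le ((hle' x).trans (maxBefore_le_fullMax _ _ _))).ne'
  obtain ⟨n, hn⟩ := exists_fullMax_eq_maxBefore hunif (ENNReal.coe_pos.1 hc0) hle'
  have hfullt : ∀ x, fullMax Γ Vs ω x ≠ ∞ := fun x => hn ▸ maxBefore_ne_top hpos n x
  have hfullc : Continuous (fullMax Γ Vs ω) := hn ▸ continuous_maxBefore hpos hc n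
  have hr : Continuous fun x => (Vs j ω x : ℝ≥0∞) / fullMax Γ Vs ω x := by
    refine continuous_iff_continuousAt.2 fun x => ?_
    exact ENNReal.Tendsto.div (ENNReal.continuous_coe.comp (hc j)).continuousAt
      (Or.inr (hfull0 x)) hfullc.continuousAt (Or.inr ENNReal.coe_ne_top)
  rw [iSup_subtype_dense hD hr]
  constructor
  · rintro ⟨x, hx⟩
    refine le_trans ?_ (le_iSup _ x)
    rw [ENNReal.le_div_iff_mul_le (Or.inl (hfull0 x)) (Or.inl (hfullt x)), ← hx, phi,
      ENNReal.mul_div_cancel hG0 hGt]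
  · intro h
    rcases isEmpty_or_nonempty K with hK | hK
    · simp [hG0] at h
    · obtain ⟨x, -, hx⟩ := isCompact_univ.exists_isMaxOn Set.univ_nonempty hr.continuousOn
      have h1 := h.trans (iSup_le fun y => hx (Set.mem_univ y))
      refine ⟨x, le_antisymm (phi_le_fullMax _ _ _) ?_⟩
      rw [ENNReal.le_div_iff_mul_le (Or.inl (hfull0 x)) (Or.inl (hfullt x)), mul_comm] at h1
      exact (ENNReal.le_div_iff_mul_le (Or.inl hG0) (Or.inl hGt)).2 h1

end

end

/-! ### The window for a candidate point and its length -/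

/-- The indicator of the event that a point at `γ` with mark `v` is a candidate for a missing
extremal function when the maximum of the other functions is `z`. -/
@[irreducible] noncomputable def candidate {D : Type*} (τ : ℝ≥0) (γ : ℝ) (v : D → ℝ≥0) (z : D → ℝ≥0∞) : ℝ≥0∞ :=
  Set.indicator {γ : ℝ | 0 < γ ∧ ⨆ x, (τ : ℝ≥0∞) / z x ≤ ENNReal.ofReal γ ∧
    ENNReal.ofReal γ ≤ ⨆ x, (v x : ℝ≥0∞) / z x} 1 γ

lemma measurable_candidate {D : Type*} [Countable D] (τ : ℝ≥0) :
    Measurable fun p : ℝ × (D → ℝ≥0) × (D → ℝ≥0∞) => candidate τ p.1 p.2.1 p.2.2 := by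
  have h1 : Measurable fun p : ℝ × (D → ℝ≥0) × (D → ℝ≥0∞) => ⨆ x, (τ : ℝ≥0∞) / p.2.2 x :=
    .iSup fun x => by fun_prop
  have h2 : Measurable fun p : ℝ × (D → ℝ≥0) × (D → ℝ≥0∞) => ⨆ x, (p.2.1 x : ℝ≥0∞) / p.2.2 x :=
    .iSup fun x => by fun_prop
  have h3 : Measurable fun p : ℝ × (D → ℝ≥0) × (D → ℝ≥0∞) => ENNReal.ofReal p.1 := by fun_prop
  have hs : MeasurableSet {p : ℝ × (D → ℝ≥0) × (D → ℝ≥0∞) | 0 < p.1 ∧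
      ⨆ x, (τ : ℝ≥0∞) / p.2.2 x ≤ ENNReal.ofReal p.1 ∧
      ENNReal.ofReal p.1 ≤ ⨆ x, (p.2.1 x : ℝ≥0∞) / p.2.2 x} :=
    (measurableSet_lt measurable_const measurable_fst).inter
      ((measurableSet_le h1 h3).inter (measurableSet_le h3 h2))
  simp only [candidate]
  exact (measurable_const (a := (1 : ℝ≥0∞))).indicator hs

/-- Infinite endpoints must be allowed, as they occur where the maximum vanishes: b = ∞ makes the
set empty, and a = ∞ with b finite makes the right-hand side infinite. -/
lemma volume_ofReal_between_le (a b : ℝ≥0∞) :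
    volume {γ : ℝ | 0 < γ ∧ b ≤ ENNReal.ofReal γ ∧ ENNReal.ofReal γ ≤ a} ≤ a - b := by
  rcases eq_or_ne b ∞ with rfl | hb
  · simp
  rcases eq_or_ne a ∞ with rfl | ha
  · simp [hb]
  calc volume {γ : ℝ | 0 < γ ∧ b ≤ ENNReal.ofReal γ ∧ ENNReal.ofReal γ ≤ a}
      ≤ volume (Set.Icc b.toReal a.toReal) := by
        refine measure_mono fun γ hγ => ⟨?_, ?_⟩
        · exact ENNReal.toReal_le_of_le_ofReal hγ.1.le hγ.2.1
        · exact (ENNReal.ofReal_le_iff_le_toReal ha).1 hγ.2.2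
    _ = a - b := by
        rw [Real.volume_Icc, ENNReal.ofReal_sub _ ENNReal.toReal_nonneg,
          ENNReal.ofReal_toReal ha, ENNReal.ofReal_toReal hb]

lemma lintegral_candidate_le {D : Type*} (τ : ℝ≥0) (v : D → ℝ≥0) (z : D → ℝ≥0∞) :
    ∫⁻ γ, candidate τ γ v z ≤ (⨆ x, (v x : ℝ≥0∞) / z x) - ⨆ x, (τ : ℝ≥0∞) / z x := by
  simp only [candidate]
  exact (lintegral_indicator_one_le _).trans (volume_ofReal_between_le _ _)

section

variable {K Ω Ω' : Type*} {Γ : ℕ → Ω → ℝ} {Vs : ℕ → Ω → K → ℝ≥0}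

/-- The maximum of the other functions lies between the maximum before j and the full maximum, so it
may replace the former in the threshold condition and the latter in the extremality condition. The
event grows, but the point is now decoupled from the rest. -/
lemma indicator_missing_le_candidate [TopologicalSpace K] [CompactSpace K] {ω : Ω} {D : Set K} (hD : Dense D) (hpos : ∀ j, 0 < Γ j ω)
    (hc : ∀ j, Continuous (Vs j ω))
    (hunif : ∀ ε : ℝ≥0, 0 < ε → ∀ᶠ k in atTop, ∀ x, phi Γ Vs k ω x ≤ ε) {τ : ℝ≥0} (hτ : 0 < τ)
    (j : ℕ) :
    (missing Γ Vs τ ω).indicator 1 j ≤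
      candidate τ (Γ j ω) (fun x : D => Vs j ω x)
        (fun x : D => fullMax (fun k => Γ (skip j k)) (fun k => Vs (skip j k)) ω x) := by
  by_cases hj : j ∈ missing Γ Vs τ ω
  swap
  · simp [hj]
  obtain ⟨h1, h2⟩ := (mem_missing_iff hD hpos hc hunif hτ j).1 hj
  have hG0 : ENNReal.ofReal (Γ j ω) ≠ 0 := by simpa using hpos j
  rw [candidate, Set.indicator_of_mem hj, Set.indicator_of_mem]
  · rfl
  refine ⟨hpos j, iSup_le fun x => ?_, h2.trans (iSup_mono fun x => ?_)⟩
  · have h3 := (h1 x).trans (maxBefore_le_fullMax_skip j ω (x : K))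
    rw [ENNReal.div_le_iff hG0 ENNReal.ofReal_ne_top, mul_comm] at h3
    exact ENNReal.div_le_of_le_mul h3
  · exact ENNReal.div_le_div_left (fullMax_skip_le_fullMax j ω (x : K)) _

variable [TopologicalSpace K] [MeasurableSpace Ω] [MeasurableSpace Ω'] {P : Measure Ω}
  {P' : Measure Ω'} {V : Ω' → K → ℝ≥0}

lemma measurable_restrict_process {D : Set K} {X : Ω → K → ℝ≥0}
    (hX : IsSampleContinuousProcess X) : Measurable fun ω (x : D) => X ω x :=
  measurable_pi_lambda _ fun x => (measurable_pi_apply (x : K)).comp hX.measurable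

lemma IsMarkedPoisson.measurable_phi (hΓV : IsMarkedPoisson Γ Vs P V P') (j : ℕ) (x : K) :
    Measurable fun ω => phi Γ Vs j ω x := by
  have h1 := hΓV.arrivals.measurable j
  have h2 : Measurable fun ω => Vs j ω x :=
    (measurable_pi_apply x).comp (hΓV.marks j).measurable
  unfold phi
  fun_prop

lemma IsMarkedPoisson.measurableSet_mem_missing (hΓV : IsMarkedPoisson Γ Vs P V P') {D : Set K}
    (hD : D.Countable) (τ : ℝ≥0) (j : ℕ) :
    MeasurableSet {ω | (∀ x : D, (τ : ℝ≥0∞) / ENNReal.ofReal (Γ j ω) ≤ maxBefore Γ Vs j ω x) ∧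
      ENNReal.ofReal (Γ j ω) ≤ ⨆ x : D, (Vs j ω x : ℝ≥0∞) / fullMax Γ Vs ω x} := by
  have := hD.to_subtype
  have h1 := hΓV.arrivals.measurable j
  have h2 : ∀ x, Measurable fun ω => Vs j ω x := fun x =>
    (measurable_pi_apply x).comp (hΓV.marks j).measurable
  have h3 : ∀ x, Measurable fun ω => fullMax Γ Vs ω x := fun x =>
    .iSup fun k => hΓV.measurable_phi k x
  have h4 : ∀ x, Measurable fun ω => maxBefore Γ Vs j ω x := fun x =>
    .iSup fun k => .iSup fun _ => hΓV.measurable_phi k x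
  refine MeasurableSet.inter ?_ (measurableSet_le h1.ennreal_ofReal (.iSup fun x => ?_))
  · have h5 : Measurable fun ω => (τ : ℝ≥0∞) / ENNReal.ofReal (Γ j ω) := by fun_prop
    have h6 := MeasurableSet.iInter fun x : D => measurableSet_le h5 (h4 x)
    have h7 : (⋂ x : D, {ω | (τ : ℝ≥0∞) / ENNReal.ofReal (Γ j ω) ≤ maxBefore Γ Vs j ω x}) =
        {ω | ∀ x : D, (τ : ℝ≥0∞) / ENNReal.ofReal (Γ j ω) ≤ maxBefore Γ Vs j ω x} := by
      ext; simp
    exact h7.subst (motive := MeasurableSet) h6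
  · have := h2 x
    have := h3 x
    fun_prop

end

/-! ### Mecke's inequality for candidates, and measurability -/

section

variable {K Ω Ω' : Type*} [TopologicalSpace K] [MeasurableSpace Ω] [MeasurableSpace Ω']
  {P : Measure Ω} [IsProbabilityMeasure P] {P' : Measure Ω'} {V Z : Ω' → K → ℝ≥0}
  {Γ : ℕ → Ω → ℝ} {Vs : ℕ → Ω → K → ℝ≥0}

/-- Mecke's inequality for the candidates, in terms of the restrictions to a countable set. -/
lemma IsMarkedPoisson.tsum_lintegral_candidate_le [IsProbabilityMeasure P']
    (hΓV : IsMarkedPoisson Γ Vs P V P') (hV : IsSampleContinuousProcess V)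
    {D : Set K} (hD : D.Countable) (τ : ℝ≥0) :
    ∑' j, ∫⁻ ω, candidate τ (Γ j ω) (fun x : D => Vs j ω x)
        (fun x : D => fullMax (fun k => Γ (skip j k)) (fun k => Vs (skip j k)) ω x) ∂P ≤
      ∫⁻ γ, ∫⁻ a, ∫⁻ ω, candidate τ γ a (fun x : D => fullMax Γ Vs ω x) ∂P
        ∂(P'.map fun ω (x : D) => V ω x) := by
  have := hD.to_subtype
  have hres : Measurable fun (v : K → ℝ≥0) (x : D) => v x :=
    measurable_pi_lambda _ fun x => measurable_pi_apply _
  have hVm : Measurable fun ω' (x : D) => V ω' x := measurable_restrict_process hV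
  have : IsProbabilityMeasure (P'.map fun ω' (x : D) => V ω' x) :=
    Measure.isProbabilityMeasure_map hVm.aemeasurable
  have hcand := measurable_candidate (D := D) τ
  have hind : IndepFun (fun ω j => Γ j ω) (fun ω j (x : D) => Vs j ω x) P :=
    IndepFun.comp (φ := fun y : ℕ → ℝ => y) (ψ := fun (u : ℕ → K → ℝ≥0) j (x : D) => u j x)
      hΓV.indep measurable_id
      (measurable_pi_lambda _ fun j => hres.comp (measurable_pi_apply j))
  have hmax : Measurable fun p : ℝ × (D → ℝ≥0) × (ℕ → ℝ) × (ℕ → D → ℝ≥0) =>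
      fun x : D => ⨆ k, (p.2.2.2 k x : ℝ≥0∞) / ENNReal.ofReal (p.2.2.1 k) :=
    measurable_pi_lambda _ fun x => .iSup fun k => by fun_prop
  have hg : Measurable fun p : ℝ × (D → ℝ≥0) × (ℕ → ℝ) × (ℕ → D → ℝ≥0) =>
      candidate τ p.1 p.2.1 fun x => ⨆ k, (p.2.2.2 k x : ℝ≥0∞) / ENNReal.ofReal (p.2.2.1 k) :=
    hcand.comp (measurable_fst.prodMk (measurable_snd.fst.prodMk hmax))
  -- Marks are restricted to the countable set D, where the suprema are measurable. Since g forms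
  -- the maximum from the sequences it receives, feeding it the remaining points yields the maximum
  -- of the other functions.
  exact tsum_lintegral_skip_le (μ := P'.map fun ω (x : D) => V ω x) (v := fun j ω (x : D) => Vs j ω x)
    (g := fun γ a y u => candidate τ γ a fun x => ⨆ k, (u k x : ℝ≥0∞) / ENNReal.ofReal (y k))
    hΓV.arrivals (fun j => measurable_restrict_process (hΓV.marks j))
    (fun j => ((hΓV.marks_law j).comp hres).map_eq)
    (hΓV.marks_indep.comp (fun _ v (x : D) => v x) fun _ => hres) hind hg

lemma lintegral_map_candidate [IsProbabilityMeasure P'] (hV : IsSampleContinuousProcess V)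
    (hZ : IsSampleContinuousProcess Z) (hZV : IndepFun Z V P') {D : Set K} (hD : D.Countable)
    (τ : ℝ≥0) (γ : ℝ) :
    ∫⁻ a, ∫⁻ ω, candidate τ γ a (fun x : D => (Z ω x : ℝ≥0∞)) ∂P'
        ∂(P'.map fun ω (x : D) => V ω x) =
      ∫⁻ ω, candidate τ γ (fun x : D => V ω x) (fun x : D => (Z ω x : ℝ≥0∞)) ∂P' := by
  have := hD.to_subtype
  have hVm : Measurable fun ω' (x : D) => V ω' x := measurable_restrict_process hV
  have hZm : Measurable fun ω' (x : D) => (Z ω' x : ℝ≥0∞) :=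
    measurable_pi_lambda _ fun x =>
      ((measurable_pi_apply (x : K)).comp hZ.measurable).coe_nnreal_ennreal
  have hind : IndepFun (fun ω' (x : D) => V ω' x) (fun ω' (x : D) => (Z ω' x : ℝ≥0∞)) P' :=
    IndepFun.comp (φ := fun (v : K → ℝ≥0) (x : D) => v x)
      (ψ := fun (z : K → ℝ≥0) (x : D) => (z x : ℝ≥0∞)) hZV.symm
      (measurable_pi_lambda _ fun x => measurable_pi_apply (x : K))
      (measurable_pi_lambda _ fun x => (measurable_pi_apply (x : K)).coe_nnreal_ennreal)
  have hcγ : Measurable fun p : (D → ℝ≥0) × (D → ℝ≥0∞) => candidate τ γ p.1 p.2 :=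
    (measurable_candidate τ).comp (measurable_const.prodMk measurable_id)
  have h1 := lintegral_map (μ := P') hcγ (hVm.prodMk hZm)
  rw [hind.map_prod_eq_prod_map_map hVm.aemeasurable hZm.aemeasurable,
    lintegral_prod _ hcγ.aemeasurable] at h1
  rw [← h1]
  refine lintegral_congr fun a => ?_
  exact (lintegral_map (hcγ.comp (measurable_const.prodMk measurable_id)) hZm).symm

/-- Off a null set the event agrees with its description through D, which involves only countably
many coordinates. -/
lemma IsMarkedPoisson.aemeasurable_indicator_missing {K : Type*} [MetricSpace K]
    [CompactSpace K] {V Z : Ω' → K → ℝ≥0} {Vs : ℕ → Ω → K → ℝ≥0} (hΓV : IsMarkedPoisson Γ Vs P V P')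
    (hZ : IsSampleContinuousProcess Z)
    (hrep : IdentDistrib (fun ω x => (Z ω x : ℝ≥0∞)) (fullMax Γ Vs) P' P) {τ : ℝ≥0} (hτ : 0 < τ)
    (j : ℕ) : AEMeasurable (fun ω => (missing Γ Vs τ ω).indicator (1 : ℕ → ℝ≥0∞) j) P := by
  obtain ⟨D, hDc, hD⟩ := TopologicalSpace.exists_countable_dense K
  refine ⟨_, (measurable_const (a := (1 : ℝ≥0∞))).indicator
    (hΓV.measurableSet_mem_missing hDc τ j), ?_⟩
  filter_upwards [hΓV.arrivals.ae_pos, hΓV.ae_eventually_phi_le hZ hrep] with ω hpos hunif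
  have hiff := mem_missing_iff hD hpos (fun j => (hΓV.marks j).continuous ω) hunif hτ j
  by_cases hj : j ∈ missing Γ Vs τ ω
  · rw [Set.indicator_of_mem hj, Set.indicator_of_mem]
    · rfl
    · exact hiff.1 hj
  · rw [Set.indicator_of_notMem hj, Set.indicator_of_notMem]
    exact fun h => hj (hiff.2 h)

end

end MaxStable

theorem mainTheorem3
    {K Ω Ω' : Type*} [MetricSpace K] [CompactSpace K]
    [MeasurableSpace Ω] [MeasurableSpace Ω']
    (P : Measure Ω) [IsProbabilityMeasure P] (P' : Measure Ω') [IsProbabilityMeasure P']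
    -- the spectral process `V` and the max-stable process `Z`, independent of each other
    (V Z : Ω' → K → ℝ≥0)
    (hV : MaxStable.IsSpectralProcess V P')
    (hZ : MaxStable.IsSampleContinuousProcess Z)
    (hZV : IndepFun Z V P')
    -- the marked Poisson process from which the approximation is computed
    (Γ : ℕ → Ω → ℝ) (Vs : ℕ → Ω → K → ℝ≥0)
    (hΓV : MaxStable.IsMarkedPoisson Γ Vs P V P')
    -- the spectral representation of `Z` (equality in distribution)
    (hrep : IdentDistrib (fun ω x => (Z ω x : ℝ≥0∞)) (MaxStable.fullMax Γ Vs) P' P)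
    (τ : ℝ≥0) (hτ : 0 < τ) :
    AEMeasurable (MaxStable.numMissing Γ Vs τ) P ∧
    ∫⁻ ω, MaxStable.numMissing Γ Vs τ ω ∂P ≤
      -- subtraction in `[0, ∞]` is truncated at `0`, that is, `a - b` is the positive part
      ∫⁻ ω, ((⨆ x, (V ω x : ℝ≥0∞) / (Z ω x : ℝ≥0∞)) - ⨆ x, (τ : ℝ≥0∞) / (Z ω x : ℝ≥0∞)) ∂P' := by
  open MaxStable in
  have haem := fun j => hΓV.aemeasurable_indicator_missing hZ hrep hτ j
  have hnum : numMissing Γ Vs τ = fun ω => ∑' j, (missing Γ Vs τ ω).indicator 1 j :=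
    funext fun ω => numMissing_eq_tsum τ ω
  refine ⟨hnum ▸ AEMeasurable.tsum haem, ?_⟩
  rw [hnum, lintegral_tsum haem]
  obtain ⟨D, hDc, hD⟩ := TopologicalSpace.exists_countable_dense K
  have := hDc.to_subtype
  have hVs := hV.toIsSampleContinuousProcess
  have hcand := measurable_candidate (D := D) τ
  calc ∑' j, ∫⁻ ω, (missing Γ Vs τ ω).indicator 1 j ∂P
      ≤ ∑' j, ∫⁻ ω, candidate τ (Γ j ω) (fun x : D => Vs j ω x)
        (fun x : D => fullMax (fun k => Γ (skip j k)) (fun k => Vs (skip j k)) ω x) ∂P := by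
        refine ENNReal.tsum_le_tsum fun j => lintegral_mono_ae ?_
        filter_upwards [hΓV.arrivals.ae_pos, hΓV.ae_eventually_phi_le hZ hrep] with ω hpos hunif
        exact indicator_missing_le_candidate hD hpos (fun j => (hΓV.marks j).continuous ω) hunif
          hτ j
    _ ≤ ∫⁻ γ, ∫⁻ a, ∫⁻ ω, candidate τ γ a (fun x : D => fullMax Γ Vs ω x) ∂P
        ∂(P'.map fun ω (x : D) => V ω x) := hΓV.tsum_lintegral_candidate_le hVs hDc τ
    _ = ∫⁻ γ, ∫⁻ a, ∫⁻ ω, candidate τ γ a (fun x : D => (Z ω x : ℝ≥0∞)) ∂P'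
        ∂(P'.map fun ω (x : D) => V ω x) := by
        -- For fixed γ and a, the integrand depends on the maximum alone, so equality in law
        -- suffices.
        refine lintegral_congr fun γ => lintegral_congr fun a => ?_
        have hca : Measurable fun z : K → ℝ≥0∞ => candidate τ γ a fun x : D => z x :=
          hcand.comp (measurable_const.prodMk (measurable_const.prodMk
            (measurable_pi_lambda _ fun x => measurable_pi_apply (x : K))))
        exact (hrep.comp hca).lintegral_eq.symm
    _ = ∫⁻ γ, ∫⁻ ω, candidate τ γ (fun x : D => V ω x) (fun x : D => (Z ω x : ℝ≥0∞)) ∂P' :=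
        lintegral_congr fun γ => lintegral_map_candidate hVs hZ hZV hDc τ γ
    _ = ∫⁻ ω, (∫⁻ γ, candidate τ γ (fun x : D => V ω x) (fun x : D => (Z ω x : ℝ≥0∞))) ∂P' := by
        rw [lintegral_lintegral_swap]
        have hVm : Measurable fun ω' (x : D) => V ω' x := measurable_restrict_process hVs
        have hZm : Measurable fun ω' (x : D) => (Z ω' x : ℝ≥0∞) :=
          measurable_pi_lambda _ fun x =>
            ((measurable_pi_apply (x : K)).comp hZ.measurable).coe_nnreal_ennreal
        exact (hcand.comp (measurable_fst.prodMk
          ((hVm.comp measurable_snd).prodMk (hZm.comp measurable_snd)))).aemeasurable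
    _ ≤ _ := by
        refine lintegral_mono fun ω => (lintegral_candidate_le τ _ _).trans ?_
        have hτc : Continuous fun x => (τ : ℝ≥0∞) / (Z ω x : ℝ≥0∞) := by
          simp_rw [div_eq_mul_inv]
          exact (ENNReal.continuous_const_mul ENNReal.coe_ne_top).comp
            (continuous_inv.comp (ENNReal.continuous_coe.comp (hZ.continuous ω)))
        -- V/Z may be discontinuous at zeros of Z, but its supremum over D only has to be bounded
        -- above. The subtracted supremum must not shrink on D; τ/Z is continuous into [0, ∞], so
        -- density applies.
        exact tsub_le_tsub (iSup_le fun x => le_iSup (fun x => (V ω x : ℝ≥0∞) / (Z ω x : ℝ≥0∞)) x)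
          (iSup_subtype_dense hD hτc).ge
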